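/- Let $\mathbb{F}_q$ be the finite field with $q$ elements and let $k\ge 1$, $\ell\ge 0$ be integers. A word $s=(s_1,\dots,s_n)$ is a $(b,m)$-constrained de Bruijn sequence if $(s_i,\dots,s_{i+m-1})\ne(s_j,\dots,s_{j+m-1})$ for all $1\le i,j\le n-m+1$ with $0<|i-j|\le b-1$. Let $\mathcal{P}_k$ be the set of primitive polynomials of degree $k$ over $\mathbb{F}_q$ (monic irreducible polynomials of degree $k$ whose roots have multiplicative order $q^k-1$). For $f\in\mathcal{P}_k$ write $f(x)/f(0)=1-\sum_{i=1}^k c_ix^i$; an m-sequence of $f$ is a word consisting of $q^k-1$ consecutive terms of a nonzero sequence satisfying $u_{n+k}=\sum_{i=1}^k c_iu_{n+k-i}$ for all $n\ge 0$. Every $f\in\mathcal{P}_k$ has an m-sequence whose last $k-1$ symbols are zeroes; choose one such word for each $f\in\mathcal{P}_k$, arbitrarily, and let $\mathcal{S}$ be the set of the chosen words. Put $$\mathbb{C}=\{\,s_1 0^{\epsilon_1}s_2 0^{\epsilon_2}\cdots s_\ell 0^{\epsilon_\ell} : s_i\in\mathcal{S},\ 0\le\epsilon_i\le k+1,\ 1\le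 i\le \ell\,\},$$ let $\mathbb{C}'$ be the set of all prefixes of words of $\mathbb{C}$, and let $$\mathbb{C}_1=\{\,uv : u\in\mathbb{C},\ v\in\mathbb{C}',\ \operatorname{length}(uv)=\ell(q^k+k)\,\}.$$ Then, for every such choice, every word of $\mathbb{C}_1$ is a $(q^k-1,2k)$-constrained de Bruijn sequence of length $\ell(q^k+k)$, and $$|\mathbb{C}_1|\ \ge\ M^\ell,\qquad M=\frac{\varphi(q^k-1)(k+2)}{k},$$ where $\varphi$ is Euler's function. -/

import Mathlib

open Polynomial

namespace ConstrainedDeBruijn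

/-- A word `s = (s_1, …, s_n)` is a `(b,k)`-constrained de Bruijn sequence if any two windows of
length `k` that start at distinct positions at distance at most `b - 1` are different.
(Positions are counted from `0` here.) -/
def IsConstrainedDeBruijn {α : Type*} (b k : ℕ) (s : List α) : Prop :=
  ∀ i j : ℕ, i + k ≤ s.length → j + k ≤ s.length → i < j → j < i + b →
    (s.drop i).take k ≠ (s.drop j).take k

section Sequences

variable {F : Type*} [Field F] [Fintype F]

/-- `f` is a primitive polynomial of degree `k` over the finite field `F` with `q` elements: it is
monic and irreducible of degree `k`, and its root in `F[X]/(f)` (the field with `q^k` elements)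
generates the multiplicative group, i.e. has order `q^k - 1`. -/
def IsPrimitivePolynomial (k : ℕ) (f : F[X]) : Prop :=
  f.Monic ∧ Irreducible f ∧ f.natDegree = k ∧
    orderOf (AdjoinRoot.root f) = Fintype.card F ^ k - 1

/-- The coefficient `c_i` of the characteristic polynomial `c(x) = 1 - ∑ c_i x^i` of the linear
feedback shift register associated with `f`; here `c(x) = f(x) / f(0)` is the scalar multiple
of `f` with constant term `1`. -/
def feedbackCoeff (f : F[X]) (i : ℕ) : F := -(f.coeff i / f.coeff 0)

/-- The infinite sequence `u` is generated by the linear shift register of length `k` with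
feedback function `x_{k+1} = ∑_{i=1}^k c_i x_{k+1-i}`. -/
def IsGeneratedBy (k : ℕ) (f : F[X]) (u : ℕ → F) : Prop :=
  ∀ n : ℕ, u (n + k) = ∑ i ∈ Finset.Icc 1 k, feedbackCoeff f i * u (n + k - i)

/-- `w` is one period, read from some starting point as a word of length `q^k - 1`, of
a nonzero sequence generated by the shift register of `f`. -/
def IsMSequence (k : ℕ) (f : F[X]) (w : List F) : Prop :=
  ∃ u : ℕ → F, IsGeneratedBy k f u ∧ u ≠ 0 ∧
    w = List.ofFn (fun i : Fin (Fintype.card F ^ k - 1) => u i)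

/-- `rep` assigns to every primitive polynomial of degree `k` an m-sequence of it, written
as an acyclic word that ends in a run of `k - 1` zeroes. (For `q = 2` there is one such word for
each polynomial; in general there are `q - 1` of them, scalar multiples of each other, and `rep`
selects one.) -/
def IsMSequenceChoice (k : ℕ) (rep : F[X] → List F) : Prop :=
  ∀ f : F[X], IsPrimitivePolynomial k f →
    IsMSequence k f (rep f) ∧ List.replicate (k - 1) (0 : F) <:+ rep f

/-- The set of the selected m-sequences, one for each primitive polynomial of degree `k`. -/
def mSequences (k : ℕ) (rep : F[X] → List F) : Set (List F) :=
  rep '' {f | IsPrimitivePolynomial k f}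

/-- The code of all words `s_1 0^{ε_1} s_2 0^{ε_2} … s_ℓ 0^{ε_ℓ}` with `s_i ∈ S` and
`0 ≤ ε_i ≤ k + 1`. -/
def code (k l : ℕ) (S : Set (List F)) : Set (List F) :=
  {w | ∃ (s : Fin l → List F) (e : Fin l → ℕ), (∀ i, s i ∈ S) ∧ (∀ i, e i ≤ k + 1) ∧
    w = (List.ofFn fun i => s i ++ List.replicate (e i) (0 : F)).flatten}

/-- All prefixes of words of a code. -/
def prefixes (C : Set (List F)) : Set (List F) := {p | ∃ c ∈ C, p <+: c}

/-- The code of fixed length `ℓ (q^k + k)`: codewords followed by prefixes of codewords. -/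
def fixedLengthCode (k l : ℕ) (S : Set (List F)) : Set (List F) :=
  {w | ∃ s₁ ∈ code k l S, ∃ s₂ ∈ prefixes (code k l S),
    w = s₁ ++ s₂ ∧ w.length = l * (Fintype.card F ^ k + k)}

end Sequences

end ConstrainedDeBruijn

/-! Let `N = q ^ k - 1` and let `α` be a root of a primitive `f`. Sequences generated by `f` have
the form `n ↦ φ (α⁻¹ ^ n)` with `φ` a linear functional on `F(α)`. As any `k` consecutive powers of
`α` form a basis, a nonzero sequence has period `N`, has no zero window of length `k`, and its
`k`-windows are distinct within a period.

Since every m-sequence ends in `k - 1` zeroes, each `k`-window of a codeword, preceded by `k - 1`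
further zeroes, is either a window of a single m-sequence or lies in a run of zeroes. Suppose two
windows of length `2k` agree at distance less than `N`. Each contains `k + 1` windows of length `k`.
If one of these vanishes, all do, and a single run has to contain both `2k`-windows; a run has
length at most `(k - 1) + (k + 1) = 2k`, which is too short. Otherwise the two windows lie in
neighbouring blocks. If the blocks have the same polynomial, distinctness of `k`-windows puts them
at distance at least `N`. If not, the common word satisfies two coprime recurrences of order `k` and
has length `2k`, so it is zero (`eq_zero_of_two_recurrences`). This is `windows_ne_of_blocks`.

For the count, each m-sequence begins with a nonzero symbol, so the blocks can be read off from left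
to right; there are `k + 2` choices of `ε` and at least `φ(N) / k` primitive polynomials. -/

namespace ConstrainedDeBruijn

/-! ### Linear recurring sequences of primitive polynomials -/

section Recurrence

variable {F : Type*} [Field F]

/-- The shift register recurrence in homogeneous form. -/
theorem isGeneratedBy_iff {k : ℕ} {f : F[X]} (h0 : f.coeff 0 ≠ 0) (u : ℕ → F) :
    IsGeneratedBy k f u ↔
      ∀ n, ∑ i ∈ Finset.range (k + 1), f.coeff i * u (n + k - i) = 0 := by
  refine forall_congr' fun n => ?_
  have hI : Finset.Icc 1 k = Finset.Ico 1 (k + 1) := by ext; simp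
  have hr : ∑ i ∈ Finset.range (k + 1), f.coeff i * u (n + k - i) =
      f.coeff 0 * u (n + k) + ∑ i ∈ Finset.Icc 1 k, f.coeff i * u (n + k - i) := by
    rw [hI, Finset.range_eq_Ico, Finset.sum_eq_sum_Ico_succ_bot (by omega)]
    simp
  have hs : ∑ i ∈ Finset.Icc 1 k, feedbackCoeff f i * u (n + k - i) =
      -((∑ i ∈ Finset.Icc 1 k, f.coeff i * u (n + k - i)) / f.coeff 0) := by
    rw [Finset.sum_div, ← Finset.sum_neg_distrib]
    refine Finset.sum_congr rfl fun i _ => ?_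
    simp only [feedbackCoeff]
    ring
  rw [hr, hs]
  constructor
  · intro h
    rw [h]
    field_simp
    ring
  · intro h
    field_simp
    linear_combination h

theorem sum_coeff_mul_root_pow {f : F[X]} {k : ℕ} (hdeg : f.natDegree = k) :
    ∑ i ∈ Finset.range (k + 1), AdjoinRoot.of f (f.coeff i) * AdjoinRoot.root f ^ i = 0 := by
  rw [← AdjoinRoot.eval₂_root f, eval₂_eq_sum_range, hdeg]

theorem IsGeneratedBy.ext {k : ℕ} {f : F[X]} {u v : ℕ → F} (hu : IsGeneratedBy k f u)
    (hv : IsGeneratedBy k f v) (h : ∀ r < k, u r = v r) (n : ℕ) : u n = v n := by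
  induction n using Nat.strong_induction_on with
  | _ n ih =>
    by_cases hn : n < k
    · exact h n hn
    · obtain ⟨m, rfl⟩ : ∃ m, n = m + k := ⟨n - k, by omega⟩
      rw [hu m, hv m]
      refine Finset.sum_congr rfl fun i hi => ?_
      have := Finset.mem_Icc.mp hi
      rw [ih _ (by omega)]

theorem IsGeneratedBy.shift {k : ℕ} {f : F[X]} {u : ℕ → F} (hu : IsGeneratedBy k f u) (a : ℕ) :
    IsGeneratedBy k f (fun n => u (n + a)) := by
  intro n
  have := hu (n + a)
  simp only
  rw [show n + k + a = n + a + k by omega, this]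
  refine Finset.sum_congr rfl fun i hi => ?_
  have := Finset.mem_Icc.mp hi
  rw [show n + a + k - i = n + k - i + a by omega]

/-- A word of length `2k` that satisfies the recurrences of two different monic irreducible
polynomials of degree `k` vanishes. -/
theorem eq_zero_of_two_recurrences {k : ℕ} {f g : F[X]} (hfm : f.Monic) (hgm : g.Monic)
    (hfi : Irreducible f) (hgi : Irreducible g) (hfd : f.natDegree = k) (hgd : g.natDegree = k)
    (hne : f ≠ g) {x : ℕ → F}
    (hf : ∀ n < k, ∑ i ∈ Finset.range (k + 1), f.coeff i * x (n + k - i) = 0)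
    (hg : ∀ n < k, ∑ i ∈ Finset.range (k + 1), g.coeff i * x (n + k - i) = 0) :
    ∀ r < 2 * k, x r = 0 := by
  -- `φ` sends `X ^ j` to `x (2k - 1 - j)`. The recurrence of `p` at `n` then reads `φ (p * X ^ (k -
  -- 1 - n)) = 0`.
  let φ : F[X] →ₗ[F] F := Polynomial.lsum fun j => LinearMap.mulRight F (x (2 * k - 1 - j))
  have hmon : ∀ j a, φ (monomial j a) = a * x (2 * k - 1 - j) := fun j a => by
    simp [φ, Polynomial.lsum_apply]
  have hvan : ∀ p : F[X], p.natDegree = k →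
      (∀ n < k, ∑ i ∈ Finset.range (k + 1), p.coeff i * x (n + k - i) = 0) →
      ∀ a : F[X], a.degree < k → φ (p * a) = 0 := by
    intro p hpd hp a ha
    have key : ∀ s < k, ∀ c, φ (p * monomial s c) = 0 := by
      intro s hs c
      have h1 : p * monomial s c =
          ∑ i ∈ Finset.range (k + 1), monomial (i + s) (p.coeff i * c) := by
        conv_lhs => rw [p.as_sum_range' (k + 1) (by omega), Finset.sum_mul]
        simp only [monomial_mul_monomial]
      rw [h1, map_sum]
      have := congrArg (c * ·) (hp (k - 1 - s) (by omega))
      simp only [mul_zero, Finset.mul_sum] at this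
      rw [← this]
      refine Finset.sum_congr rfl fun i hi => ?_
      have := Finset.mem_range.mp hi
      rw [hmon, show k - 1 - s + k - i = 2 * k - 1 - (i + s) by omega]
      ring
    have hak : a.natDegree < k ∨ a = 0 := by
      by_cases h : a = 0
      · exact Or.inr h
      · exact Or.inl ((natDegree_lt_iff_degree_lt h).mpr ha)
    rcases hak with hak | rfl
    · rw [a.as_sum_range' k hak, Finset.mul_sum, map_sum]
      exact Finset.sum_eq_zero fun s hs => key s (Finset.mem_range.mp hs) _
    · simp
  have hcop : IsCoprime f g := by
    rw [hfi.coprime_iff_not_dvd]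
    intro hd
    exact hne (eq_of_monic_of_associated hfm hgm
      ((hfi.dvd_irreducible_iff_associated hgi).mp hd))
  obtain ⟨a, b, hab⟩ := hcop
  intro r hr
  have hdf : f.degree = k := by rw [degree_eq_natDegree hfm.ne_zero, hfd]
  have hdg : g.degree = k := by rw [degree_eq_natDegree hgm.ne_zero, hgd]
  -- Bézout gives `p = f * (p * a) + g * (p * b)`. Reducing `p * b` modulo `f` and moving the
  -- quotient to the other term makes both cofactors of degree less than `k`.
  let p : F[X] := monomial (2 * k - 1 - r) 1
  let b' := (p * b) %ₘ f
  let a' := p * a + g * ((p * b) /ₘ f)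
  have hp : p = f * a' + g * b' := by
    have h1 : b' + f * ((p * b) /ₘ f) = p * b := modByMonic_add_div _ f
    simp only [a']
    linear_combination (-p) * hab - g * h1
  have hb' : b'.degree < k := hdf ▸ degree_modByMonic_lt _ hfm
  have ha' : a'.degree < k := by
    by_contra hcon
    have h2 : f * a' = p - g * b' := by rw [hp]; ring
    have hpd : p.degree < ((k + k : ℕ) : WithBot ℕ) := by
      refine (degree_monomial_le _ _).trans_lt ?_
      exact_mod_cast (by omega : 2 * k - 1 - r < k + k)
    have hgb : (g * b').degree < ((k + k : ℕ) : WithBot ℕ) := by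
      rw [degree_mul, hdg, Nat.cast_add]
      exact WithBot.add_lt_add_left (by simp) hb'
    have h3 : (f * a').degree < ((k + k : ℕ) : WithBot ℕ) := by
      rw [h2]
      exact (degree_sub_le _ _).trans_lt (max_lt hpd hgb)
    rw [degree_mul, hdf, Nat.cast_add] at h3
    exact absurd h3 (not_lt.mpr (add_le_add le_rfl (not_lt.mp hcon)))
  have h4 : φ p = 0 := by
    rw [hp, map_add, hvan f hfd hf a' ha', hvan g hgd hg b' hb', add_zero]
  rw [hmon, one_mul] at h4
  rwa [show 2 * k - 1 - (2 * k - 1 - r) = r by omega] at h4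

variable [Fintype F]

theorem one_le_card_pow_sub_one {k : ℕ} (hk : 1 ≤ k) : 1 ≤ Fintype.card F ^ k - 1 := by
  have h1 : 1 < Fintype.card F := Fintype.one_lt_card
  have h2 := Nat.one_lt_pow (by omega : k ≠ 0) h1
  omega

theorem IsPrimitivePolynomial.root_pow {k : ℕ} {f : F[X]} (hf : IsPrimitivePolynomial k f) :
    AdjoinRoot.root f ^ (Fintype.card F ^ k - 1) = 1 := by
  rw [← hf.2.2.2, pow_orderOf_eq_one]

theorem IsPrimitivePolynomial.root_ne_zero {k : ℕ} {f : F[X]} (hk : 1 ≤ k)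
    (hf : IsPrimitivePolynomial k f) : AdjoinRoot.root f ≠ 0 := by
  have : Fact (Irreducible f) := ⟨hf.2.1⟩
  intro h0
  have h := hf.root_pow
  have hN := one_le_card_pow_sub_one (F := F) hk
  rw [h0, zero_pow (by omega)] at h
  exact zero_ne_one h

theorem IsPrimitivePolynomial.coeff_zero_ne_zero {k : ℕ} {f : F[X]} (hk : 1 ≤ k)
    (hf : IsPrimitivePolynomial k f) : f.coeff 0 ≠ 0 := by
  have : Fact (Irreducible f) := ⟨hf.2.1⟩
  intro h0
  obtain ⟨g, hg⟩ := X_dvd_iff.mpr h0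
  have hroot := hf.root_ne_zero hk
  rcases hf.2.1.isUnit_or_isUnit hg with h | h
  · exact not_isUnit_X h
  · obtain ⟨c, hc⟩ := h
    apply hroot
    have hev : AdjoinRoot.mk f (X * g) = 0 := AdjoinRoot.mk_eq_zero.mpr hg.dvd
    rw [map_mul, AdjoinRoot.mk_X] at hev
    rcases mul_eq_zero.mp hev with h | h
    · exact h
    · have hu : IsUnit (AdjoinRoot.mk f g) := (hc ▸ c.isUnit : IsUnit g).map _
      exact absurd h hu.ne_zero

/-- The inverse of the root appears because `f.coeff i` multiplies the term with index `n + k - i`: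
the recurrence is `f(α) = 0` multiplied by `α⁻¹ ^ (n + k)`. -/
theorem isGeneratedBy_functional {k : ℕ} {f : F[X]} [Fact (Irreducible f)] (hk : 1 ≤ k)
    (hf : IsPrimitivePolynomial k f) (φ : AdjoinRoot f →ₗ[F] F) :
    IsGeneratedBy k f (fun n => φ ((AdjoinRoot.root f)⁻¹ ^ n)) := by
  rw [isGeneratedBy_iff (hf.coeff_zero_ne_zero hk)]
  intro n
  have hα := hf.root_ne_zero hk
  have h := congrArg (fun z => φ ((AdjoinRoot.root f)⁻¹ ^ (n + k) * z))
    (sum_coeff_mul_root_pow hf.2.2.1)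
  simp only [Finset.mul_sum, map_sum, mul_zero, map_zero] at h
  rw [← h]
  refine Finset.sum_congr rfl fun i hi => ?_
  have hi' : i ≤ n + k := by have := Finset.mem_range.mp hi; omega
  rw [← smul_eq_mul, ← map_smul, Algebra.smul_def, AdjoinRoot.algebraMap_eq]
  congr 1
  have : (AdjoinRoot.root f)⁻¹ ^ (n + k) =
      (AdjoinRoot.root f)⁻¹ ^ (n + k - i) * (AdjoinRoot.root f)⁻¹ ^ i := by
    rw [← pow_add]; congr 1; omega
  rw [this, inv_pow _ i]
  field_simp

theorem exists_functional {k : ℕ} {f : F[X]} [Fact (Irreducible f)] (hk : 1 ≤ k)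
    (hf : IsPrimitivePolynomial k f) (x : ℕ → F) :
    ∃ φ : AdjoinRoot f →ₗ[F] F, ∀ r < k, φ ((AdjoinRoot.root f)⁻¹ ^ r) = x r := by
  have hα := hf.root_ne_zero hk
  let b := (AdjoinRoot.powerBasis' hf.1).basis
  let ψ : AdjoinRoot f →ₗ[F] F := b.constr F (fun i => x (k - 1 - i))
  refine ⟨ψ ∘ₗ LinearMap.mulLeft F (AdjoinRoot.root f ^ (k - 1)), fun r hr => ?_⟩
  have hdim : k - 1 - r < (AdjoinRoot.powerBasis' hf.1).dim := by
    simp only [AdjoinRoot.powerBasis'_dim, hf.2.2.1]; omega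
  have h1 : b ⟨k - 1 - r, hdim⟩ = AdjoinRoot.root f ^ (k - 1) * (AdjoinRoot.root f)⁻¹ ^ r := by
    simp only [b, PowerBasis.basis_eq_pow, AdjoinRoot.powerBasis'_gen]
    rw [show k - 1 = k - 1 - r + r by omega, pow_add, inv_pow,
      show k - 1 - r + r - r = k - 1 - r by omega]
    field_simp
  rw [LinearMap.comp_apply, LinearMap.mulLeft_apply, ← h1, Module.Basis.constr_basis]
  congr 1
  simp only
  omega

/-- Up to order, the elements `c * α⁻¹ ^ r` with `r < k` are the power basis scaled by the nonzero
`d = c * α⁻¹ ^ (k - 1)`. -/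
theorem functional_eq_zero {k : ℕ} {f : F[X]} [Fact (Irreducible f)] (hk : 1 ≤ k)
    (hf : IsPrimitivePolynomial k f) {φ : AdjoinRoot f →ₗ[F] F} {c : AdjoinRoot f} (hc : c ≠ 0)
    (h : ∀ r < k, φ (c * (AdjoinRoot.root f)⁻¹ ^ r) = 0) : φ = 0 := by
  have hα := hf.root_ne_zero hk
  let b := (AdjoinRoot.powerBasis' hf.1).basis
  let d := c * (AdjoinRoot.root f)⁻¹ ^ (k - 1)
  have hd : d ≠ 0 := mul_ne_zero hc (pow_ne_zero _ (inv_ne_zero hα))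
  have h0 : φ ∘ₗ LinearMap.mulLeft F d = 0 := by
    refine b.ext fun i => ?_
    have hi : (i : ℕ) < k := by
      have := i.2
      simp only [AdjoinRoot.powerBasis'_dim, hf.2.2.1] at this
      exact this
    have := h (k - 1 - i) (by omega)
    rw [LinearMap.comp_apply, LinearMap.mulLeft_apply, LinearMap.zero_apply, ← this]
    congr 1
    simp only [b, d, PowerBasis.basis_eq_pow, AdjoinRoot.powerBasis'_gen]
    rw [mul_assoc]
    congr 1
    have : (AdjoinRoot.root f)⁻¹ ^ (k - 1) =
        (AdjoinRoot.root f)⁻¹ ^ (k - 1 - i) * (AdjoinRoot.root f)⁻¹ ^ (i : ℕ) := by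
      rw [← pow_add]; congr 1; omega
    rw [this, inv_pow _ (i : ℕ)]
    field_simp
  ext z
  have := LinearMap.congr_fun h0 (d⁻¹ * z)
  rw [LinearMap.comp_apply, LinearMap.mulLeft_apply, mul_inv_cancel_left₀ hd] at this
  simpa using this

theorem IsGeneratedBy.exists_functional {k : ℕ} {f : F[X]} [Fact (Irreducible f)] (hk : 1 ≤ k)
    (hf : IsPrimitivePolynomial k f) {u : ℕ → F} (hu : IsGeneratedBy k f u) :
    ∃ φ : AdjoinRoot f →ₗ[F] F, ∀ n, u n = φ ((AdjoinRoot.root f)⁻¹ ^ n) := by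
  obtain ⟨φ, hφ⟩ := ConstrainedDeBruijn.exists_functional hk hf u
  exact ⟨φ, hu.ext (isGeneratedBy_functional hk hf φ) fun r hr => (hφ r hr).symm⟩

theorem IsGeneratedBy.periodic {k : ℕ} {f : F[X]} (hk : 1 ≤ k) (hf : IsPrimitivePolynomial k f)
    {u : ℕ → F} (hu : IsGeneratedBy k f u) (n : ℕ) : u (n + (Fintype.card F ^ k - 1)) = u n := by
  have : Fact (Irreducible f) := ⟨hf.2.1⟩
  obtain ⟨φ, hφ⟩ := hu.exists_functional hk hf
  rw [hφ, hφ, pow_add, inv_pow _ (_ - 1), hf.root_pow]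
  simp

theorem IsGeneratedBy.eq_zero_of_window {k : ℕ} {f : F[X]} (hk : 1 ≤ k)
    (hf : IsPrimitivePolynomial k f) {u : ℕ → F} (hu : IsGeneratedBy k f u) {m : ℕ}
    (h : ∀ r < k, u (m + r) = 0) : u = 0 := by
  have : Fact (Irreducible f) := ⟨hf.2.1⟩
  obtain ⟨φ, hφ⟩ := hu.exists_functional hk hf
  have hα := hf.root_ne_zero hk
  have : φ = 0 := functional_eq_zero hk hf (pow_ne_zero m (inv_ne_zero hα)) fun r hr => by
    rw [← pow_add, ← hφ, h r hr]
  ext n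
  simp [hφ, this]

/-- If the windows agree, `φ` vanishes on `(α⁻¹ ^ m - α⁻¹ ^ m') * α⁻¹ ^ r` for `r < k`; the first
factor is nonzero because `α` has order `q ^ k - 1`. -/
theorem IsGeneratedBy.window_injective {k : ℕ} {f : F[X]} (hk : 1 ≤ k)
    (hf : IsPrimitivePolynomial k f) {u : ℕ → F} (hu : IsGeneratedBy k f u) (h0 : u ≠ 0)
    {m m' : ℕ} (hm : m < Fintype.card F ^ k - 1) (hm' : m' < Fintype.card F ^ k - 1)
    (h : ∀ r < k, u (m + r) = u (m' + r)) : m = m' := by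
  have : Fact (Irreducible f) := ⟨hf.2.1⟩
  obtain ⟨φ, hφ⟩ := hu.exists_functional hk hf
  have hα := hf.root_ne_zero hk
  by_contra hne
  have hc : (AdjoinRoot.root f)⁻¹ ^ m - (AdjoinRoot.root f)⁻¹ ^ m' ≠ 0 := by
    intro hc
    rw [sub_eq_zero, inv_pow, inv_pow, inv_inj] at hc
    rw [← hf.2.2.2] at hm hm'
    exact hne (pow_injOn_Iio_orderOf hm hm' hc)
  apply h0
  have : φ = 0 := functional_eq_zero hk hf hc fun r hr => by
    rw [sub_mul, ← pow_add, ← pow_add, map_sub, ← hφ, ← hφ, h r hr, sub_self]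
  ext n
  simp [hφ, this]

/-- The sequence with initial state `0, …, 0, 1` is read from its symbol `1` on; periodicity brings
the `k - 1` initial zeroes to the end. -/
theorem exists_mSequence {k : ℕ} {f : F[X]} (hk : 1 ≤ k) (hf : IsPrimitivePolynomial k f) :
    ∃ w, IsMSequence k f w ∧ List.replicate (k - 1) (0 : F) <:+ w := by
  have : Fact (Irreducible f) := ⟨hf.2.1⟩
  obtain ⟨φ, hφ⟩ := exists_functional hk hf (fun r => if r = k - 1 then 1 else 0)
  have hgen := isGeneratedBy_functional hk hf φ
  have hN : k ≤ Fintype.card F ^ k - 1 := by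
    have := Nat.lt_pow_self (n := k) (Fintype.one_lt_card (α := F))
    omega
  refine ⟨_, ⟨_, hgen.shift (k - 1), ?_, rfl⟩, ?_⟩
  · intro h
    have h1 := hφ (k - 1) (by omega)
    have h2 := congrFun h 0
    simp only [zero_add, Pi.zero_apply] at h2
    rw [h2, if_pos rfl] at h1
    exact zero_ne_one h1
  · rw [List.suffix_iff_eq_drop]
    refine List.ext_getElem (by simp; omega) fun i h1 h2 => ?_
    simp only [List.length_replicate] at h1
    simp only [List.getElem_replicate, List.length_replicate, List.length_ofFn, List.getElem_drop,
      List.getElem_ofFn]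
    rw [show Fintype.card F ^ k - 1 - (k - 1) + i + (k - 1) = i + (Fintype.card F ^ k - 1) by omega]
    rw [hgen.periodic hk hf i, hφ i (by omega), if_neg (by omega)]

end Recurrence

end ConstrainedDeBruijn

namespace ConstrainedDeBruijn

/-! ### Windows of length `2k` in a concatenation of blocks -/

section Words

variable {F : Type*} [Field F] [Fintype F]

/-- Let `y` consist of consecutive stretches that start at the positions `P t`: a period of
`v (f t)`, whose last `k - 1` terms are zeroes, followed by `e t ≤ k + 1` zeroes. Then windows of
`y` of length `2k` at a distance less than a period are different. -/
theorem windows_ne_of_blocks {k n N : ℕ} (hk : 1 ≤ k) (hN : Fintype.card F ^ k - 1 = N)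
    {f : ℕ → F[X]} (hf : ∀ t < n, IsPrimitivePolynomial k (f t)) {e P : ℕ → ℕ} (hP0 : P 0 = 0)
    (hP : ∀ t < n, P (t + 1) = P t + N + e t) (he : ∀ t < n, e t ≤ k + 1)
    {v : F[X] → ℕ → F} (hv : ∀ g, IsPrimitivePolynomial k g → IsGeneratedBy k g (v g) ∧ v g ≠ 0)
    {y : ℕ → F} (hy : ∀ t < n, ∀ m < N + k - 1, y (P t + m) = v (f t) m)
    (hz : ∀ t < n, ∀ m < e t + k - 1, y (P t + N + m) = 0)
    {i j : ℕ} (hij : i < j) (hji : j < i + N) (hjn : j + k < P n)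
    (heq : ∀ r < 2 * k, y (i + r) = y (j + r)) : False := by
  have hmono : ∀ t t', t < t' → t' ≤ n → P t + N + e t ≤ P t' := by
    intro t t' htt' ht'
    induction t', htt' using Nat.le_induction with
    | base => rw [hP t (by omega)]
    | succ s hs ih => have := ih (by omega); rw [hP s (by omega)]; omega
  have hloc : ∀ s ≤ n, ∀ p < P s, ∃ t < n, P t ≤ p ∧ p < P t + N + e t := by
    intro s hs p hp
    induction s with
    | zero => omega
    | succ s ih =>
      by_cases h : p < P s
      · exact ih (by omega) h
      · exact ⟨s, by omega, by omega, by rw [← hP s (by omega)]; exact hp⟩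
  have hgap : ∀ t < n, ∀ p, P t + N ≤ p → p < P t + N + e t → ∀ r < k, y (p + r) = 0 := by
    intro t ht p h1 h2 r hr
    have := hz t ht (p + r - (P t + N)) (by omega)
    rwa [show P t + N + (p + r - (P t + N)) = p + r by omega] at this
  have hyp : ∀ t < n, ∀ p, P t ≤ p → p < P t + N → ∀ r < k,
      y (p + r) = v (f t) (p - P t + r) := by
    intro t ht p h1 h2 r hr
    rw [← hy t ht (p - P t + r) (by omega)]
    congr 1
    omega
  have hnz : ∀ t < n, ∀ p, P t ≤ p → p < P t + N → ¬ ∀ r < k, y (p + r) = 0 := by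
    intro t ht p h1 h2 h
    obtain ⟨hg, h0⟩ := hv _ (hf t ht)
    refine h0 (hg.eq_zero_of_window hk (hf t ht) (m := p - P t) fun r hr => ?_)
    rw [← hyp t ht p h1 h2 r hr, h r hr]
  have hsame : ∀ t < n, ∀ p p', P t ≤ p → p < P t + N → P t ≤ p' → p' < P t + N →
      (∀ r < k, y (p + r) = y (p' + r)) → p = p' := by
    intro t ht p p' h1 h2 h3 h4 h
    obtain ⟨hg, h0⟩ := hv _ (hf t ht)
    have := hg.window_injective hk (hf t ht) h0 (m := p - P t) (m' := p' - P t) (by omega)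
      (by omega) fun r hr => by rw [← hyp t ht p h1 h2 r hr, ← hyp t ht p' h3 h4 r hr, h r hr]
    omega
  have hwin : ∀ s ≤ k, ∀ r < k, y (i + s + r) = y (j + s + r) := by
    intro s hs r hr
    have := heq (s + r) (by omega)
    rwa [← add_assoc, ← add_assoc] at this
  have hzero : ∀ p < P n, (∀ r < k, y (p + r) = 0) →
      ∃ t < n, P t + N ≤ p ∧ p < P t + N + e t := by
    intro p hp h
    obtain ⟨t, ht, h1, h2⟩ := hloc n le_rfl p hp
    by_cases h3 : p < P t + N
    · exact absurd h (hnz t ht p h1 h3)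
    · exact ⟨t, ht, by omega, h2⟩
  -- Zero windows in different gaps have a full period between them, so `i + s` and `j + s` share a
  -- gap.
  have hpair : ∀ s ≤ k, (∀ r < k, y (i + s + r) = 0) →
      ∃ t < n, P t + N ≤ i + s ∧ j + s < P t + N + e t := by
    intro s hs h
    obtain ⟨t, ht, h1, h2⟩ := hzero (i + s) (by omega) h
    obtain ⟨t', ht', h3, h4⟩ := hzero (j + s) (by omega)
      fun r hr => by rw [← hwin s hs r hr, h r hr]
    rcases lt_trichotomy t t' with h5 | h5 | h5
    · have := hmono t t' h5 (by omega); omega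
    · subst h5; exact ⟨t, ht, h1, h4⟩
    · have := hmono t' t h5 (by omega); omega
  -- Zero windows spread in both directions: as `i < j` lie in one gap after the shift by `s`, the
  -- start `i + s + 1` is still in the gap, and so is `j + s - 1`.
  have hup : ∀ s ≤ k, (∀ r < k, y (i + s + r) = 0) → ∀ d, s + d ≤ k →
      ∀ r < k, y (i + (s + d) + r) = 0 := by
    intro s hs h d
    induction d with
    | zero => intro _; simpa using h
    | succ d ih =>
      intro hd
      obtain ⟨t, ht, h1, h2⟩ := hpair (s + d) (by omega) (ih (by omega))
      exact hgap t ht _ (by omega) (by omega)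
  have hdown : ∀ s ≤ k, (∀ r < k, y (i + s + r) = 0) → ∀ r < k, y (i + 0 + r) = 0 := by
    intro s
    induction s with
    | zero => intro _ h; exact h
    | succ s ih =>
      intro hs h
      obtain ⟨t, ht, h1, h2⟩ := hpair (s + 1) hs h
      refine ih (by omega) fun r hr => ?_
      rw [hwin s (by omega) r hr]
      exact hgap t ht (j + s) (by omega) (by omega) r hr
  have hnotzero : ∀ s ≤ k, ¬ ∀ r < k, y (i + s + r) = 0 := by
    intro s hs h
    have h0 := hdown s hs h
    obtain ⟨t, ht, h1, h2⟩ := hpair 0 (by omega) h0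
    -- One gap would contain all starts from `i` to `j + k`, which are at least `k + 2` in number,
    -- while `e t ≤ k + 1`.
    obtain ⟨t', ht', h3, h4⟩ := hpair k le_rfl (by simpa using hup 0 (by omega) h0 k (by omega))
    have := he t ht
    have := he t' ht'
    rcases lt_trichotomy t t' with h5 | h5 | h5
    · have := hmono t t' h5 (by omega)
      have := hup 0 (by omega) h0 (P t' - i) (by omega)
      refine hnz t' ht' (P t') le_rfl (by omega) fun r hr => ?_
      have := this r hr
      rwa [show i + (0 + (P t' - i)) + r = P t' + r by omega] at this
    · subst h5; omega
    · have := hmono t' t h5 (by omega); omega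
  have hblock : ∀ s ≤ k, ∃ t, t + 1 < n ∧ P t ≤ i + s ∧ i + s < P t + N ∧
      P (t + 1) ≤ j + s ∧ j + s < P (t + 1) + N := by
    intro s hs
    have hi := hnotzero s hs
    have hj : ¬ ∀ r < k, y (j + s + r) = 0 := fun h =>
      hi fun r hr => by rw [hwin s hs r hr, h r hr]
    obtain ⟨t, ht, h1, h2⟩ := hloc n le_rfl (i + s) (by omega)
    obtain ⟨t', ht', h3, h4⟩ := hloc n le_rfl (j + s) (by omega)
    have h5 : i + s < P t + N := by
      by_contra h; exact hi (hgap t ht _ (by omega) h2)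
    have h6 : j + s < P t' + N := by
      by_contra h; exact hj (hgap t' ht' _ (by omega) h4)
    have h7 : t ≤ t' := by
      by_contra h
      have := hmono t' t (by omega) (by omega)
      omega
    have h8 : t ≠ t' := by
      rintro rfl
      have := hsame t ht _ _ h1 h5 h3 h6 (hwin s hs)
      omega
    have h9 : t' = t + 1 := by
      by_contra h
      have h10 := hmono (t + 1) t' (by omega) (by omega)
      have h11 := hP t ht
      omega
    subst h9
    exact ⟨t, ht', h1, h5, h3, h6⟩
  obtain ⟨t, ht, h1, h2, h3, h4⟩ := hblock 0 (by omega)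
  simp only [add_zero] at h1 h2 h3 h4
  have hPt := hP t (by omega)
  -- If the first window reached the start of block `t + 1`, the second would by then be in block `t
  -- + 2`, at distance at least `N`.
  have hik : i + k < P (t + 1) := by
    by_contra h
    obtain ⟨t', ht', h1', h2', h3', h4'⟩ := hblock (P (t + 1) - i) (by omega)
    have h5 : t' = t + 1 := by
      rcases lt_trichotomy t' (t + 1) with h | h | h
      · have := hmono t' (t + 1) h (by omega); omega
      · exact h
      · have := hmono (t + 1) t' h (by omega); omega
    subst h5
    have := hP (t + 1) (by omega)
    omega
  obtain ⟨h5, h6⟩ : i + k < P t + N ∧ j + k < P (t + 1) + N := by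
    obtain ⟨t', ht', h1', h2', h3', h4'⟩ := hblock k le_rfl
    have h5 : t' = t := by
      rcases lt_trichotomy t' t with h | h | h
      · have := hmono t' t h (by omega); omega
      · exact h
      · have := hmono t t' h (by omega)
        have : P (t + 1) ≤ P t' := by
          rcases Nat.lt_or_ge (t + 1) t' with h' | h'
          · have := hmono (t + 1) t' h' (by omega); omega
          · rw [show t' = t + 1 by omega]
        omega
    subst h5
    exact ⟨h2', h4'⟩
  by_cases hfg : f t = f (t + 1)
  · obtain ⟨hg, h0⟩ := hv _ (hf t (by omega))
    have := hg.window_injective hk (hf t (by omega)) h0 (m := i - P t) (m' := j - P (t + 1))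
      (by omega) (by omega) fun r hr => by
        rw [← hyp t (by omega) i h1 h2 r hr, hfg, ← hyp (t + 1) ht j h3 h4 r hr,
          heq r (by omega)]
    omega
  · have hrec : ∀ t < n, ∀ p, P t ≤ p → p + k < P t + N → ∀ m < k,
        ∑ s ∈ Finset.range (k + 1), (f t).coeff s * y (p + (m + k - s)) = 0 := by
      intro t ht p h1 h2 m hm
      have hft := hf t ht
      have h := (isGeneratedBy_iff (hft.coeff_zero_ne_zero hk) _).mp (hv _ hft).1 (p - P t + m)
      rw [← h]
      refine Finset.sum_congr rfl fun s hs => ?_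
      have := Finset.mem_range.mp hs
      rw [← hy t ht _ (by omega)]
      congr 2
      omega
    have hft := hf t (by omega)
    have hft' := hf (t + 1) ht
    have hx := eq_zero_of_two_recurrences hft.1 hft'.1 hft.2.1 hft'.2.1 hft.2.2.1 hft'.2.2.1 hfg
      (x := fun r => y (i + r)) (hrec t (by omega) i h1 h5) (by
        intro m hm
        rw [← hrec (t + 1) ht j h3 h6 m hm]
        refine Finset.sum_congr rfl fun s hs => ?_
        rw [heq _ (by omega)])
    exact hnz t (by omega) i h1 h2 fun r hr => hx r (by omega)

end Words

/-! ### Codewords as block words, and the constraint -/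

section BlockWord

variable {F : Type*} [Field F]

/-- The word `s_1 0^{ε_1} s_2 0^{ε_2} …` described by a list of pairs of a polynomial and
a number of zeroes. -/
def blockWord (rep : F[X] → List F) (bs : List (F[X] × ℕ)) : List F :=
  bs.flatMap fun b => rep b.1 ++ List.replicate b.2 0

theorem blockWord_append (rep : F[X] → List F) (bs cs : List (F[X] × ℕ)) :
    blockWord rep (bs ++ cs) = blockWord rep bs ++ blockWord rep cs :=
  List.flatMap_append

theorem blockWord_cons (rep : F[X] → List F) (b : F[X] × ℕ) (bs : List (F[X] × ℕ)) :
    blockWord rep (b :: bs) = rep b.1 ++ List.replicate b.2 0 ++ blockWord rep bs :=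
  List.flatMap_cons

theorem blockWord_split (rep : F[X] → List F) (bs : List (F[X] × ℕ)) {t : ℕ} (ht : t < bs.length) :
    blockWord rep bs = blockWord rep (bs.take t) ++ (rep bs[t].1 ++ List.replicate bs[t].2 0) ++
      blockWord rep (bs.drop (t + 1)) := by
  conv_lhs => rw [← List.take_append_drop t bs, List.drop_eq_getElem_cons ht, blockWord_append,
    blockWord_cons, ← List.append_assoc]

theorem blockWord_take_succ (rep : F[X] → List F) (bs : List (F[X] × ℕ)) {t : ℕ}
    (ht : t < bs.length) :
    blockWord rep (bs.take (t + 1)) =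
      blockWord rep (bs.take t) ++ (rep bs[t].1 ++ List.replicate bs[t].2 0) := by
  rw [← List.take_concat_get' bs t ht, blockWord_append, blockWord_cons]
  simp [blockWord]

theorem replicate_suffix_append_replicate {w : List F} {a : ℕ} (h : List.replicate a 0 <:+ w)
    (b : ℕ) : List.replicate a 0 <:+ w ++ List.replicate b 0 := by
  obtain ⟨x, rfl⟩ := h
  refine ⟨x ++ List.replicate b 0, ?_⟩
  rw [List.append_assoc, List.append_assoc, ← List.replicate_add, ← List.replicate_add, add_comm]

variable [Fintype F]

theorem IsMSequence.length_eq {k : ℕ} {f : F[X]} {w : List F} (h : IsMSequence k f w) :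
    w.length = Fintype.card F ^ k - 1 := by
  obtain ⟨u, -, -, rfl⟩ := h
  simp

/-- A selected m-sequence, preceded by `k - 1` zeroes, is a stretch of a nonzero sequence
generated by the same shift register. -/
theorem IsMSequenceChoice.exists_padded {k : ℕ} (hk : 1 ≤ k) {rep : F[X] → List F}
    (hrep : IsMSequenceChoice k rep) : ∃ v : F[X] → ℕ → F, ∀ f, IsPrimitivePolynomial k f →
      IsGeneratedBy k f (v f) ∧ v f ≠ 0 ∧
        ∀ m < Fintype.card F ^ k - 1 + k - 1,
          (List.replicate (k - 1) 0 ++ rep f)[m]? = some (v f m) := by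
  suffices h : ∀ f, ∃ v : ℕ → F, IsPrimitivePolynomial k f →
      IsGeneratedBy k f v ∧ v ≠ 0 ∧ ∀ m < Fintype.card F ^ k - 1 + k - 1,
          (List.replicate (k - 1) 0 ++ rep f)[m]? = some (v m) from
    ⟨fun f => (h f).choose, fun f => (h f).choose_spec⟩
  intro f
  by_cases hf : IsPrimitivePolynomial k f
  swap
  · exact ⟨0, fun h => absurd h hf⟩
  obtain ⟨⟨u, hu, hu0, hw⟩, hsuf⟩ := hrep f hf
  generalize hNdef : Fintype.card F ^ k - 1 = N at *
  have hper : ∀ n, u (n + N) = u n := by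
    intro n; rw [← hNdef]; exact hu.periodic hk hf n
  have hkN : k - 1 ≤ N := by simpa [hw] using hsuf.length_le
  refine ⟨fun n => u (n + (N - (k - 1))), fun _ => ⟨hu.shift _, ?_, ?_⟩⟩
  · intro h
    apply hu0
    ext n
    have := congrFun h (n + (k - 1))
    simp only [Pi.zero_apply] at this
    rwa [show n + (k - 1) + (N - (k - 1)) = n + N by omega, hper] at this
  · intro m hm
    by_cases hmk : m < k - 1
    · rw [List.getElem?_append_left (by simpa using hmk), List.getElem?_replicate, if_pos hmk]
      have h1 := List.suffix_iff_eq_drop.mp hsuf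
      have h2 := congrArg (fun l => l[m]?) h1
      simp only [List.getElem?_replicate, if_pos hmk, List.getElem?_drop, hw, List.length_ofFn,
        List.length_replicate, List.getElem?_ofFn] at h2
      rw [dif_pos (by omega)] at h2
      rw [h2, add_comm]
    · rw [List.getElem?_append_right (by simp; omega), hw, List.getElem?_ofFn,
        dif_pos (by simp; omega)]
      simp only [List.length_replicate]
      rw [← hper]
      congr 2
      omega

/-- A leading zero would extend the `k - 1` cyclically preceding zeroes to a zero window of length
`k`. -/
theorem IsMSequenceChoice.head_ne_zero {k : ℕ} (hk : 1 ≤ k) {rep : F[X] → List F}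
    (hrep : IsMSequenceChoice k rep) {f : F[X]} (hf : IsPrimitivePolynomial k f) :
    ∃ a l, rep f = a :: l ∧ a ≠ 0 := by
  obtain ⟨v, hv⟩ := hrep.exists_padded hk
  obtain ⟨hg, h0, hm⟩ := hv f hf
  have hN := one_le_card_pow_sub_one (F := F) hk
  have hlen := (hrep f hf).1.length_eq
  obtain ⟨a, l, hal⟩ := List.exists_cons_of_length_pos (l := rep f) (by omega)
  refine ⟨a, l, hal, ?_⟩
  rintro rfl
  refine h0 (hg.eq_zero_of_window hk hf (m := 0) fun r hr => ?_)
  have := hm r (by omega)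
  rw [hal, show List.replicate (k - 1) (0 : F) ++ 0 :: l = List.replicate k 0 ++ l by
    conv_rhs => rw [show k = k - 1 + 1 by omega, List.replicate_add]
    simp, List.getElem?_append_left (by simpa using hr), List.getElem?_replicate, if_pos hr] at this
  rw [zero_add]
  exact (Option.some.inj this).symm

theorem IsMSequenceChoice.injOn {k : ℕ} (hk : 1 ≤ k) {rep : F[X] → List F}
    (hrep : IsMSequenceChoice k rep) : Set.InjOn rep {f | IsPrimitivePolynomial k f} := by
  intro f hf g hg hfg
  obtain ⟨⟨u, hu, hu0, hw⟩, -⟩ := hrep f hf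
  obtain ⟨⟨u', hu', -, hw'⟩, -⟩ := hrep g hg
  by_contra hne
  have hN := one_le_card_pow_sub_one (F := F) hk
  have huu : ∀ n, u n = u' n := by
    intro n
    have h1 : ∀ n, u (n % (Fintype.card F ^ k - 1)) = u n :=
      Function.Periodic.map_mod_nat fun n => hu.periodic hk hf n
    have h2 : ∀ n, u' (n % (Fintype.card F ^ k - 1)) = u' n :=
      Function.Periodic.map_mod_nat fun n => hu'.periodic hk hg n
    have h3 := List.ofFn_injective (hw.symm.trans (hfg.trans hw'))
    have h4 := congrFun h3 ⟨n % (Fintype.card F ^ k - 1), Nat.mod_lt _ (by omega)⟩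
    rw [← h1, ← h2]
    exact h4
  obtain rfl : u = u' := funext huu
  have h0 := eq_zero_of_two_recurrences hf.1 hg.1 hf.2.1 hg.2.1 hf.2.2.1 hg.2.2.1 hne
    (fun n _ => (isGeneratedBy_iff (hf.coeff_zero_ne_zero hk) u).mp hu n)
    (fun n _ => (isGeneratedBy_iff (hg.coeff_zero_ne_zero hk) u).mp hu' n)
  exact hu0 (hu.eq_zero_of_window hk hf (m := 0) fun r hr => by
    rw [zero_add]; exact h0 r (by omega))

theorem isConstrainedDeBruijn_blockWord {k : ℕ} (hk : 1 ≤ k) {rep : F[X] → List F}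
    (hrep : IsMSequenceChoice k rep) {bs : List (F[X] × ℕ)}
    (hbs : ∀ b ∈ bs, IsPrimitivePolynomial k b.1 ∧ b.2 ≤ k + 1) :
    IsConstrainedDeBruijn (Fintype.card F ^ k - 1) (2 * k) (blockWord rep bs) := by
  intro i j hi hj hij hji heq
  obtain ⟨v, hv⟩ := hrep.exists_padded hk
  let f : ℕ → F[X] := fun t => (bs.getD t (0, 0)).1
  let e : ℕ → ℕ := fun t => (bs.getD t (0, 0)).2
  have hfe : ∀ t, ∀ ht : t < bs.length, f t = bs[t].1 ∧ e t = bs[t].2 := by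
    intro t ht
    simp [f, e, ht]
  have hprim : ∀ t < bs.length, IsPrimitivePolynomial k (f t) := fun t ht => by
    rw [(hfe t ht).1]; exact (hbs _ (List.getElem_mem ht)).1
  have hsplit : ∀ t < bs.length, blockWord rep bs = blockWord rep (bs.take t) ++
      (rep (f t) ++ List.replicate (e t) 0) ++ blockWord rep (bs.drop (t + 1)) := fun t ht => by
    rw [(hfe t ht).1, (hfe t ht).2]; exact blockWord_split rep bs ht
  have hsucc : ∀ t < bs.length, blockWord rep (bs.take (t + 1)) = blockWord rep (bs.take t) ++
      (rep (f t) ++ List.replicate (e t) 0) := fun t ht => by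
    rw [(hfe t ht).1, (hfe t ht).2]; exact blockWord_take_succ rep bs ht
  have hsuf : ∀ t ≤ bs.length,
      List.replicate (k - 1) 0 <:+ List.replicate (k - 1) 0 ++ blockWord rep (bs.take t) := by
    intro t ht
    cases t with
    | zero => simp [blockWord]
    | succ t =>
      rw [hsucc t ht]
      exact (replicate_suffix_append_replicate (hrep _ (hprim t ht)).2 _).trans
        ((List.suffix_append _ _).trans (List.suffix_append _ _))
  -- The padding gives the first block `k - 1` zeroes before it, like all others. Positions of the
  -- word move by `k - 1`, so index `P t` of `y` is where the zeroes preceding block `t` begin.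
  let y : ℕ → F := fun p => (List.replicate (k - 1) 0 ++ blockWord rep bs)[p]?.getD 0
  have hpad : ∀ t < bs.length, ∃ A : List F, A.length = (blockWord rep (bs.take t)).length ∧
      List.replicate (k - 1) 0 ++ blockWord rep bs = A ++ ((List.replicate (k - 1) 0 ++ rep (f t)) ++
        (List.replicate (e t) 0 ++ blockWord rep (bs.drop (t + 1)))) := by
    intro t ht
    obtain ⟨A, hA⟩ := hsuf t ht.le
    refine ⟨A, by simpa [add_comm] using congrArg List.length hA, ?_⟩
    rw [hsplit t ht]
    simp only [← List.append_assoc]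
    rw [hA]
  have hlen : ∀ t < bs.length, (rep (f t)).length = Fintype.card F ^ k - 1 := fun t ht =>
    (hrep _ (hprim t ht)).1.length_eq
  refine windows_ne_of_blocks hk rfl (n := bs.length) (f := f) (e := e)
    (P := fun t => (blockWord rep (bs.take t)).length) hprim (by simp [blockWord]) ?_ ?_
    (fun g hg => ⟨(hv g hg).1, (hv g hg).2.1⟩) (y := y) ?_ ?_
    (i := i + (k - 1)) (j := j + (k - 1)) (by omega) (by omega) ?_ ?_
  · intro t ht
    simp only [hsucc t ht, List.length_append, hlen t ht, List.length_replicate, add_assoc]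
  · intro t ht
    rw [(hfe t ht).2]; exact (hbs _ (List.getElem_mem ht)).2
  · intro t ht m hm
    obtain ⟨A, hA, hAeq⟩ := hpad t ht
    simp only [y]
    rw [hAeq, ← hA, List.getElem?_append_right (by omega), Nat.add_sub_cancel_left,
      List.getElem?_append_left (by simp [hlen t ht]; omega), (hv _ (hprim t ht)).2.2 m hm]
    rfl
  · intro t ht m hm
    obtain ⟨A, hA, hAeq⟩ := hpad t ht
    obtain ⟨B, hB⟩ := (hrep _ (hprim t ht)).2
    have hBl := congrArg List.length hB
    simp only [List.length_append, List.length_replicate, hlen t ht] at hBl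
    simp only [y]
    rw [hAeq, ← hB, show A ++ ((List.replicate (k - 1) 0 ++ (B ++ List.replicate (k - 1) 0)) ++
        (List.replicate (e t) 0 ++ blockWord rep (bs.drop (t + 1)))) =
      (A ++ (List.replicate (k - 1) 0 ++ B)) ++ (List.replicate (k - 1 + e t) 0 ++
        blockWord rep (bs.drop (t + 1))) by
        rw [List.replicate_add]; simp only [List.append_assoc],
      List.getElem?_append_right (by simp; omega),
      List.getElem?_append_left (by simp; omega), List.getElem?_replicate, if_pos (by simp; omega)]
    rfl
  · simp only [List.take_length]
    omega
  · intro r hr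
    have h1 := congrArg (fun l => l[r]?) heq
    simp only [List.getElem?_take, if_pos hr, List.getElem?_drop] at h1
    simp only [y]
    rw [List.getElem?_append_right (by simp; omega), List.getElem?_append_right (by simp; omega)]
    simp only [List.length_replicate]
    rw [show i + (k - 1) + r - (k - 1) = i + r by omega,
      show j + (k - 1) + r - (k - 1) = j + r by omega, h1]

theorem IsConstrainedDeBruijn.of_prefix {α : Type*} {b m : ℕ} {s w : List α} (h : s <+: w)
    (hw : IsConstrainedDeBruijn b m w) : IsConstrainedDeBruijn b m s := by
  obtain ⟨x, rfl⟩ := h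
  intro i j hi hj hij hji heq
  refine hw i j (by simp; omega) (by simp; omega) hij hji ?_
  rwa [List.drop_append_of_le_length (by omega), List.drop_append_of_le_length (by omega),
    List.take_append_of_le_length (by simp; omega), List.take_append_of_le_length (by simp; omega)]

theorem mem_code_iff {k l : ℕ} {rep : F[X] → List F} {w : List F} :
    w ∈ code k l (mSequences k rep) ↔ ∃ b : Fin l → F[X] × ℕ,
      (∀ i, IsPrimitivePolynomial k (b i).1 ∧ (b i).2 ≤ k + 1) ∧
        w = blockWord rep (List.ofFn b) := by
  have hword : ∀ b : Fin l → F[X] × ℕ, blockWord rep (List.ofFn b) =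
      (List.ofFn fun i => rep (b i).1 ++ List.replicate (b i).2 (0 : F)).flatten := fun b => by
    rw [blockWord, List.flatMap_def, List.map_ofFn]; rfl
  constructor
  · rintro ⟨s, e, hs, he, rfl⟩
    choose f hf hfs using hs
    refine ⟨fun i => (f i, e i), fun i => ⟨hf i, he i⟩, ?_⟩
    rw [hword]
    simp only [hfs]
  · rintro ⟨b, hb, rfl⟩
    exact ⟨fun i => rep (b i).1, fun i => (b i).2, fun i => ⟨_, (hb i).1, rfl⟩,
      fun i => (hb i).2, hword b⟩

theorem isConstrainedDeBruijn_of_mem_fixedLengthCode {k l : ℕ} (hk : 1 ≤ k)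
    {rep : F[X] → List F} (hrep : IsMSequenceChoice k rep) {w : List F}
    (hw : w ∈ fixedLengthCode k l (mSequences k rep)) :
    IsConstrainedDeBruijn (Fintype.card F ^ k - 1) (2 * k) w := by
  obtain ⟨u, hu, x, ⟨c, hc, hxc⟩, rfl, -⟩ := hw
  obtain ⟨b, hb, rfl⟩ := mem_code_iff.mp hu
  obtain ⟨b', hb', rfl⟩ := mem_code_iff.mp hc
  -- A codeword followed by a prefix of a codeword is a prefix of a block word with `2l` blocks.
  refine IsConstrainedDeBruijn.of_prefix ((List.prefix_append_right_inj _).mpr hxc) ?_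
  rw [← blockWord_append]
  refine isConstrainedDeBruijn_blockWord hk hrep fun z hz => ?_
  rw [List.mem_append, List.mem_ofFn, List.mem_ofFn] at hz
  rcases hz with ⟨i, rfl⟩ | ⟨i, rfl⟩
  exacts [hb i, hb' i]

end BlockWord

end ConstrainedDeBruijn

namespace ConstrainedDeBruijn

/-! ### Counting primitive polynomials and codewords -/

section Count

variable {F : Type*} [Field F]

theorem natDegree_minpoly_of_forall_mem_zpowers {E : Type*} [Field E] [Algebra F E]
    [FiniteDimensional F E] {a : Eˣ} (ha : ∀ x, x ∈ Subgroup.zpowers a) :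
    (minpoly F (a : E)).natDegree = Module.finrank F E := by
  rw [← Field.primitive_element_iff_minpoly_natDegree_eq, eq_top_iff]
  intro x _
  by_cases hx : x = 0
  · rw [hx]; exact zero_mem _
  · obtain ⟨n, hn⟩ := ha (Units.mk0 x hx)
    have := congrArg Units.val hn
    simp only [Units.val_zpow_eq_zpow_val, Units.val_mk0] at this
    rw [← this]
    exact zpow_mem (IntermediateField.mem_adjoin_simple_self F (a : E)) n

theorem orderOf_root_minpoly {E : Type*} [Field E] [Algebra F E] {a : E} (ha : IsIntegral F a) :
    orderOf (AdjoinRoot.root (minpoly F a)) = orderOf a := by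
  have : Fact (Irreducible (minpoly F a)) := ⟨minpoly.irreducible ha⟩
  let g : AdjoinRoot (minpoly F a) →+* E :=
    AdjoinRoot.lift (algebraMap F E) a (by rw [← aeval_def]; exact minpoly.aeval F a)
  have := orderOf_injective (g : AdjoinRoot (minpoly F a) →* E) g.injective
    (AdjoinRoot.root (minpoly F a))
  rw [← this]
  simp [g]

theorem replicate_append_cancel {a b : ℕ} {x y : List F} (hx : x.head? ≠ some 0)
    (hy : y.head? ≠ some 0) (h : List.replicate a 0 ++ x = List.replicate b 0 ++ y) :
    a = b ∧ x = y := by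
  induction a generalizing b with
  | zero =>
    cases b with
    | zero => simpa using h
    | succ b =>
      simp only [List.replicate_zero, List.nil_append] at h
      exact absurd (by rw [h]; simp [List.replicate_succ]) hx
  | succ a ih =>
    cases b with
    | zero =>
      simp only [List.replicate_zero, List.nil_append] at h
      exact absurd (by rw [← h]; simp [List.replicate_succ]) hy
    | succ b =>
      simp only [List.replicate_succ, List.cons_append, List.cons.injEq, true_and] at h
      obtain ⟨h1, h2⟩ := ih h
      exact ⟨by rw [h1], h2⟩

variable [Fintype F]

/-- There are at least `φ(q^k - 1) / k` primitive polynomials of degree `k`. -/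
theorem exists_finset_primitive {k : ℕ} (hk : 1 ≤ k) :
    ∃ T : Finset F[X], (∀ f ∈ T, IsPrimitivePolynomial k f) ∧
      Nat.totient (Fintype.card F ^ k - 1) ≤ k * T.card := by
  classical
  obtain ⟨p, hp⟩ := CharP.exists F
  have hpp : Fact p.Prime := ⟨CharP.char_is_prime F p⟩
  have hk0 : NeZero k := ⟨by omega⟩
  let E := FiniteField.Extension F p k
  have hE : Nat.card E = Fintype.card F ^ k := by
    rw [FiniteField.natCard_extension, Nat.card_eq_fintype_card]
  let _ : Fintype E := Fintype.ofFinite E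
  have hU : Fintype.card Eˣ = Fintype.card F ^ k - 1 := by
    rw [Fintype.card_units, ← hE, Nat.card_eq_fintype_card]
  let G : Finset Eˣ := Finset.univ.filter fun a => orderOf a = Fintype.card F ^ k - 1
  have hG : G.card = Nat.totient (Fintype.card F ^ k - 1) :=
    IsCyclic.card_orderOf_eq_totient (by rw [hU])
  have hprim : ∀ a ∈ G, IsPrimitivePolynomial k (minpoly F (a : E)) := by
    intro a ha
    have ho : orderOf a = Fintype.card F ^ k - 1 := (Finset.mem_filter.mp ha).2
    have hint : IsIntegral F (a : E) := IsIntegral.of_finite F _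
    refine ⟨minpoly.monic hint, minpoly.irreducible hint, ?_, ?_⟩
    · rw [natDegree_minpoly_of_forall_mem_zpowers, FiniteField.finrank_extension]
      intro x
      have htop : Subgroup.zpowers a = ⊤ := by
        rw [← Subgroup.card_eq_iff_eq_top, Nat.card_zpowers, ho, Nat.card_eq_fintype_card, hU]
      rw [htop]
      trivial
    · rw [orderOf_root_minpoly hint, orderOf_units, ho]
  refine ⟨G.image fun a : Eˣ => minpoly F (a : E), fun f hf => ?_, ?_⟩
  · obtain ⟨a, ha, rfl⟩ := Finset.mem_image.mp hf
    exact hprim a ha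
  · rw [← hG]
    -- Generators of the unit group with the same minimal polynomial are among its at most `k`
    -- roots.
    refine Finset.card_le_mul_card_image _ _ fun f hf => ?_
    obtain ⟨a, ha, rfl⟩ := Finset.mem_image.mp hf
    obtain ⟨hmon, -, hdeg, -⟩ := hprim a ha
    refine le_trans ?_ (((Multiset.toFinset_card_le _).trans
      (card_roots' ((minpoly F (a : E)).map (algebraMap F E)))).trans
        ((natDegree_map_le).trans hdeg.le))
    refine Finset.card_le_card_of_injOn (fun b : Eˣ => (b : E)) (fun b hb => ?_)
      (fun b _ c _ h => Units.ext h)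
    have hb' := (Finset.mem_filter.mp hb).2
    simp only [Finset.mem_coe, Multiset.mem_toFinset]
    rw [mem_roots (hmon.map _).ne_zero, IsRoot.def, eval_map_algebraMap, ← hb']
    exact minpoly.aeval F _

theorem head?_blockWord_append {k : ℕ} (hk : 1 ≤ k) {rep : F[X] → List F}
    (hrep : IsMSequenceChoice k rep) {bs : List (F[X] × ℕ)}
    (hbs : ∀ b ∈ bs, IsPrimitivePolynomial k b.1) {x : List F} (hx : x.head? ≠ some 0) :
    (blockWord rep bs ++ x).head? ≠ some 0 := by
  cases bs with
  | nil => exact hx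
  | cons b bs =>
    obtain ⟨a, l, hal, ha⟩ := hrep.head_ne_zero hk (hbs b (by simp))
    rw [blockWord_cons, hal]
    simpa using ha

/-- Decoding from the left: m-sequences have a common length, and the zeroes after one of them end
exactly where a nonzero symbol begins the next block or the tail. -/
theorem blockWord_append_injective {k : ℕ} (hk : 1 ≤ k) {rep : F[X] → List F}
    (hrep : IsMSequenceChoice k rep) {bs cs : List (F[X] × ℕ)}
    (hbs : ∀ b ∈ bs, IsPrimitivePolynomial k b.1) (hcs : ∀ b ∈ cs, IsPrimitivePolynomial k b.1)
    (hlen : bs.length = cs.length) {x y : List F} (hx : x.head? ≠ some 0) (hy : y.head? ≠ some 0)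
    (h : blockWord rep bs ++ x = blockWord rep cs ++ y) : bs = cs := by
  induction bs generalizing cs with
  | nil => exact (List.length_eq_zero_iff.mp hlen.symm).symm
  | cons b bs ih =>
    cases cs with
    | nil => simp at hlen
    | cons c cs =>
      rw [blockWord_cons, blockWord_cons] at h
      simp only [List.append_assoc] at h
      have hb := hbs b (by simp)
      have hc := hcs c (by simp)
      have hbs' : ∀ b ∈ bs, IsPrimitivePolynomial k b.1 := fun z hz => hbs z (by simp [hz])
      have hcs' : ∀ b ∈ cs, IsPrimitivePolynomial k b.1 := fun z hz => hcs z (by simp [hz])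
      obtain ⟨h1, h2⟩ := List.append_inj h
        (by rw [(hrep _ hb).1.length_eq, (hrep _ hc).1.length_eq])
      obtain ⟨h3, h4⟩ := replicate_append_cancel (head?_blockWord_append hk hrep hbs' hx)
        (head?_blockWord_append hk hrep hcs' hy) h2
      rw [ih hbs' hcs' (by simpa using hlen) h4, Prod.ext (hrep.injOn hk hb hc h1) h3]

theorem length_blockWord_le {k : ℕ} (hk : 1 ≤ k) {rep : F[X] → List F}
    (hrep : IsMSequenceChoice k rep) {bs : List (F[X] × ℕ)}
    (hbs : ∀ b ∈ bs, IsPrimitivePolynomial k b.1 ∧ b.2 ≤ k + 1) :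
    (blockWord rep bs).length ≤ bs.length * (Fintype.card F ^ k + k) := by
  induction bs with
  | nil => simp [blockWord]
  | cons b bs ih =>
    obtain ⟨h1, h2⟩ := hbs b (by simp)
    have hN := one_le_card_pow_sub_one (F := F) hk
    have := ih fun z hz => hbs z (by simp [hz])
    rw [blockWord_cons]
    simp only [List.length_append, List.length_replicate, List.length_cons, add_mul, one_mul,
      (hrep _ h1).1.length_eq] at this ⊢
    omega

theorem length_blockWord_eq {k : ℕ} (hk : 1 ≤ k) {rep : F[X] → List F}
    (hrep : IsMSequenceChoice k rep) {bs : List (F[X] × ℕ)}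
    (hbs : ∀ b ∈ bs, IsPrimitivePolynomial k b.1 ∧ b.2 = k + 1) :
    (blockWord rep bs).length = bs.length * (Fintype.card F ^ k + k) := by
  induction bs with
  | nil => simp [blockWord]
  | cons b bs ih =>
    obtain ⟨h1, h2⟩ := hbs b (by simp)
    have hN := one_le_card_pow_sub_one (F := F) hk
    have := ih fun z hz => hbs z (by simp [hz])
    rw [blockWord_cons]
    simp only [List.length_append, List.length_replicate, List.length_cons, add_mul, one_mul,
      (hrep _ h1).1.length_eq] at this ⊢
    omega

theorem pow_le_ncard_fixedLengthCode {k : ℕ} (hk : 1 ≤ k) (l : ℕ) {rep : F[X] → List F}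
    (hrep : IsMSequenceChoice k rep) {T : Finset F[X]}
    (hT : ∀ f ∈ T, IsPrimitivePolynomial k f) :
    (T.card * (k + 2)) ^ l ≤ (fixedLengthCode k l (mSequences k rep)).ncard := by
  classical
  let D : Finset (Fin l → F[X] × ℕ) :=
    Fintype.piFinset fun _ => T ×ˢ Finset.range (k + 2)
  let u : (Fin l → F[X] × ℕ) → List F := fun b => blockWord rep (List.ofFn b)
  -- With all exponents equal to `k + 1` the word has length exactly `l * (q ^ k + k)`, so its
  -- prefixes can complete any `u b`. Reusing the polynomials of `b` avoids a separate choice.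
  let c : (Fin l → F[X] × ℕ) → List F := fun b =>
    blockWord rep (List.ofFn fun i => ((b i).1, k + 1))
  let x : (Fin l → F[X] × ℕ) → List F := fun b =>
    (c b).take (l * (Fintype.card F ^ k + k) - (u b).length)
  have hD : ∀ b ∈ D, ∀ i, IsPrimitivePolynomial k (b i).1 ∧ (b i).2 ≤ k + 1 := by
    intro b hb i
    have h := Fintype.mem_piFinset.mp hb i
    rw [Finset.mem_product, Finset.mem_range] at h
    exact ⟨hT _ h.1, by omega⟩
  have hDcard : D.card = (T.card * (k + 2)) ^ l := by
    simp [D, Fintype.card_piFinset]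
  -- Finiteness is needed because `Set.ncard` is `0` on infinite sets.
  have hfin : (fixedLengthCode k l (mSequences k rep)).Finite :=
    (List.finite_length_eq F (l * (Fintype.card F ^ k + k))).subset (by
      rintro w ⟨_, _, _, _, _, h⟩
      exact h)
  have hhead : ∀ b ∈ D, (x b).head? ≠ some 0 := by
    intro b hb
    have := head?_blockWord_append hk hrep (bs := List.ofFn fun i => ((b i).1, k + 1))
      (x := []) (by
        intro z hz
        obtain ⟨i, rfl⟩ := List.mem_ofFn.mp hz
        exact (hD b hb i).1) (by simp)
    rw [List.append_nil] at this
    simp only [x]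
    rw [List.head?_take]
    split
    · simp
    · exact this
  have hmem : ∀ b ∈ D, u b ++ x b ∈ fixedLengthCode k l (mSequences k rep) := by
    intro b hb
    have hu := length_blockWord_le hk hrep (bs := List.ofFn b) (by
      intro z hz
      obtain ⟨i, rfl⟩ := List.mem_ofFn.mp hz
      exact hD b hb i)
    have hc := length_blockWord_eq hk hrep (bs := List.ofFn fun i => ((b i).1, k + 1)) (by
      intro z hz
      obtain ⟨i, rfl⟩ := List.mem_ofFn.mp hz
      exact ⟨(hD b hb i).1, rfl⟩)
    rw [List.length_ofFn] at hu hc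
    refine ⟨u b, mem_code_iff.mpr ⟨b, hD b hb, rfl⟩, x b,
      ⟨c b, mem_code_iff.mpr ⟨fun i => ((b i).1, k + 1), fun i => ⟨(hD b hb i).1, le_rfl⟩, rfl⟩,
        List.take_prefix _ _⟩,
      rfl, ?_⟩
    simp only [List.length_append, x, List.length_take, c, hc]
    simp only [u]
    omega
  have hinj : Set.InjOn (fun b => u b ++ x b) (D : Set (Fin l → F[X] × ℕ)) := by
    intro b hb b' hb' h
    refine List.ofFn_injective (blockWord_append_injective hk hrep ?_ ?_ (by simp)
      (hhead b hb) (hhead b' hb') h)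
    · intro z hz
      obtain ⟨i, rfl⟩ := List.mem_ofFn.mp hz
      exact (hD b hb i).1
    · intro z hz
      obtain ⟨i, rfl⟩ := List.mem_ofFn.mp hz
      exact (hD b' hb' i).1
  rw [← hDcard, ← Set.ncard_coe_finset D, ← hinj.ncard_image]
  refine Set.ncard_le_ncard ?_ hfin
  rintro _ ⟨b, hb, rfl⟩
  exact hmem b hb

end Count

end ConstrainedDeBruijn

/-! ### The main theorem -/

theorem mainTheorem5 {F : Type*} [Field F] [Fintype F] (q k l : ℕ) (hq : Fintype.card F = q)
    (hk : 1 ≤ k) :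
    (∃ rep : Polynomial F → List F, ConstrainedDeBruijn.IsMSequenceChoice k rep) ∧
    ∀ rep : Polynomial F → List F, ConstrainedDeBruijn.IsMSequenceChoice k rep →
      (∀ w ∈ ConstrainedDeBruijn.fixedLengthCode k l (ConstrainedDeBruijn.mSequences k rep),
        w.length = l * (q ^ k + k) ∧
        ConstrainedDeBruijn.IsConstrainedDeBruijn (q ^ k - 1) (2 * k) w) ∧
      ((Nat.totient (q ^ k - 1) : ℝ) * (k + 2) / k) ^ l ≤
        ((ConstrainedDeBruijn.fixedLengthCode k l
          (ConstrainedDeBruijn.mSequences k rep)).ncard : ℝ) := by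
  classical
  subst hq
  refine ⟨⟨fun f => if hf : ConstrainedDeBruijn.IsPrimitivePolynomial k f then
    (ConstrainedDeBruijn.exists_mSequence hk hf).choose else [], fun f hf => ?_⟩,
    fun rep hrep => ⟨fun w hw => ⟨?_, ?_⟩, ?_⟩⟩
  · simp only [dif_pos hf]
    exact (ConstrainedDeBruijn.exists_mSequence hk hf).choose_spec
  · obtain ⟨_, _, _, _, _, h⟩ := hw
    exact h
  · exact ConstrainedDeBruijn.isConstrainedDeBruijn_of_mem_fixedLengthCode hk hrep hw
  · obtain ⟨T, hT, hcard⟩ := ConstrainedDeBruijn.exists_finset_primitive (F := F) hk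
    have h1 := ConstrainedDeBruijn.pow_le_ncard_fixedLengthCode hk l hrep hT
    have h2 : (((T.card * (k + 2)) ^ l : ℕ) : ℝ) ≤ _ := Nat.cast_le.mpr h1
    refine le_trans ?_ h2
    push_cast
    have hk' : (0 : ℝ) < k := by exact_mod_cast hk
    have h3 : (Nat.totient (Fintype.card F ^ k - 1) : ℝ) ≤ k * T.card := by exact_mod_cast hcard
    refine pow_le_pow_left₀ (by positivity) ?_ l
    rw [div_le_iff₀ hk']
    nlinarith
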